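/- Let $d\ge 2$ be an integer. An arbitrarily oriented unit hypercube in $\mathbb{R}^d$ is the image of $[-\frac12,\frac12]^d$ under a rigid motion (an isometry) of $\mathbb{R}^d$. The geometric intersection graph of a finite set of such hypercubes has the hypercubes as its vertices, two different ones being adjacent iff they have a common point. A connected dominating set (CDS) of a graph $G$ is a set $D$ of vertices such that every vertex is in $D$ or adjacent to a vertex in $D$, and such that $D$ induces a connected subgraph in each connected component of $G$. In the online minimum CDS problem (MCDS), pairwise different unit hypercubes are revealed one by one; after each arrival a deterministic online algorithm must hold a CDS of the geometric intersection graph of the hypercubes revealed so far. It decides without knowledge of the future, it may add the new hypercube and any earlier ones to its solution, and it may never remove a selected one. For an input sequence $\sigma$, let $\mathrm{ALG}_\sigma$ be the final size of the algorithm's solution and $opt_{cds}(\sigma)$ the minimum size of a CDS of the intersection graph of all hypercubes in $\sigma$. For $k\ge 1$, the (absolute) competitive ratio of the algorithm for $opt_{cds}=k$ is the smallest $\alpha\in[0,\infty]$ such that $\mathrm{ALG}_\sigma\le\alpha\cdot opt_{cds}(\sigma)$ for every finite input sequence $\sigma$ with $opt_{cds}(\sigma)=k$. Theorem. For every deterministic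 online algorithm for MCDS of arbitrarily oriented $d$-dimensional unit hypercubes, the competitive ratio is at least $11\cdot 2^{d-2}-1$ for $opt_{cds}=1$, and at least $\frac{11\cdot 2^{d-2}}{3}$ for $opt_{cds}=k$, for every integer $k\ge 2$. -/

import Mathlib

open scoped ENNReal

/-- The axis-parallel (solid, closed) cube of side length one centred at the origin of `ℝ^d`. -/
def standardUnitCube (d : ℕ) : Set (EuclideanSpace ℝ (Fin d)) :=
  {x | ∀ i, |x i| ≤ 1 / 2}

/-- The family of arbitrarily oriented unit hypercubes of `ℝ^d`: the images of the standard unit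
cube under the rigid motions (bijective isometries) of `ℝ^d`. -/
def UnitHypercube (d : ℕ) : Type :=
  {Q : Set (EuclideanSpace ℝ (Fin d)) //
    ∃ e : EuclideanSpace ℝ (Fin d) ≃ᵢ EuclideanSpace ℝ (Fin d), Q = e '' standardUnitCube d}

/-- The geometric intersection graph of a set `S` of unit hypercubes: its vertices are the members
of `S`, and two different members are adjacent iff they have a point in common. -/
def intersectionGraph {d : ℕ} (S : Set (UnitHypercube d)) : SimpleGraph S where
  Adj A B := A ≠ B ∧ (A.1.1 ∩ B.1.1).Nonempty
  symm := ⟨fun _ _ h => ⟨h.1.symm, by rw [Set.inter_comm]; exact h.2⟩⟩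
  loopless := ⟨fun _ h => h.1 rfl⟩

/-- `D` is a dominating set of `G`: each vertex is in `D` or adjacent to a vertex in `D`. -/
def IsDominatingSet {V : Type*} (G : SimpleGraph V) (D : Set V) : Prop :=
  ∀ v, v ∈ D ∨ ∃ u ∈ D, G.Adj v u

/-- `D` is a connected dominating set of `G`: it is dominating, and in each connected component
of `G` it induces a connected subgraph. (For connected `G`, this says that `G[D]` is connected.) -/
def IsConnectedDominatingSet {V : Type*} (G : SimpleGraph V) (D : Set V) : Prop :=
  IsDominatingSet G D ∧ ∀ C : G.ConnectedComponent, (G.induce (D ∩ C.supp)).Connected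

/-- The finite set `D` of hypercubes is a feasible solution once the objects of `σ` have been
revealed: it consists of revealed objects, and it is a connected dominating set of their
intersection graph. -/
def IsCDSFor {d : ℕ} (σ : List (UnitHypercube d)) (D : Finset (UnitHypercube d)) : Prop :=
  (∀ A ∈ D, A ∈ σ) ∧
    IsConnectedDominatingSet (intersectionGraph {A | A ∈ σ}) {A | A.1 ∈ D}

/-- `opt_cds`: the size of a minimum connected dominating set of the objects of `σ`. -/
noncomputable def optCDS {d : ℕ} (σ : List (UnitHypercube d)) : ℕ :=
  sInf {n | ∃ D : Finset (UnitHypercube d), IsCDSFor σ D ∧ D.card = n}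

/-- A deterministic online algorithm for minimum connected dominating set of unit hypercubes of
`ℝ^d`. The objects are revealed one by one; an input is the list of (pairwise different) objects
in the order of their arrival, and `sol σ` is the solution held after the objects of `σ` have been
revealed. The solution is feasible at all times, and decisions are irrevocable: an object that was
selected stays selected, while a new arrival allows to select it and any object seen earlier. -/
structure OnlineMCDSAlgorithm (d : ℕ) where
  sol : List (UnitHypercube d) → Finset (UnitHypercube d)
  feasible : ∀ σ : List (UnitHypercube d), σ.Nodup → IsCDSFor σ (sol σ)
  irrevocable : ∀ (σ : List (UnitHypercube d)) (A : UnitHypercube d),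
    (σ ++ [A]).Nodup → sol σ ⊆ sol (σ ++ [A])

/-- The (absolute) competitive ratio of `alg` on the inputs `σ` with `optCDS σ = k`: the smallest
`α ∈ [0, ∞]` such that `|ALG_σ| ≤ α * |OPT_σ|` for all of these inputs. -/
noncomputable def OnlineMCDSAlgorithm.competitiveRatio {d : ℕ} (alg : OnlineMCDSAlgorithm d)
    (k : ℕ) : ℝ≥0∞ :=
  sInf {α : ℝ≥0∞ | ∀ σ : List (UnitHypercube d), σ.Nodup → optCDS σ = k →
    ((alg.sol σ).card : ℝ≥0∞) ≤ α * (optCDS σ : ℝ≥0∞)}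

/-! The adversary works with cubes that look like unrelated paths until one last cube reveals a
cheap centre. Cubes centred on the lattice of spacing `51/100` meet exactly when their indices
differ by at most 1 in every coordinate. Per cluster there are `2^(n+1)` disjoint columns of five
cubes, and `2^n` bridges, each joining the middles of two columns opposite in the first coordinate.

The first, third and fifth cubes of the columns come first. They are pairwise disjoint, so all are
selected. The other cubes then come and are cut vertices between selected cubes, so they are
selected too: `11 * 2^n` in each cluster (`card_columns_union_bridges`).

Finally one tilted cube per cluster meets every cube of it (`latticeCube_inter_tiltedCube`). The
clusters lie in disjoint strips, so the optimum is their number (`optCDS_eq_of_clusters`), and the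
ratio is at least `11 * 2^n` for every `k ≥ 1`. -/

/-! ### Forced vertices of connected dominating sets -/

/-- An isolated vertex belongs to every dominating set. -/
theorem IsDominatingSet.mem_of_isolated {V : Type*} {G : SimpleGraph V} {D : Set V}
    (hD : IsDominatingSet G D) {v : V} (hv : ∀ u, ¬ G.Adj v u) : v ∈ D := by
  rcases hD v with h | ⟨u, -, hu⟩
  · exact h
  · exact absurd hu (hv u)

/-- A vertex `c` that separates two of its neighbours, both in the connected dominating set `D`,
belongs to `D` itself. -/
theorem IsConnectedDominatingSet.mem_of_separates {V : Type*} {G : SimpleGraph V} {D : Set V}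
    (hD : IsConnectedDominatingSet G D) {c x y : V} (X : Set V) (hxc : G.Adj x c)
    (hyc : G.Adj y c) (hx : x ∈ D) (hy : y ∈ D) (hxX : x ∈ X) (hyX : y ∉ X)
    (hX : ∀ u v, u ∈ X → v ∉ X → G.Adj u v → v = c) : c ∈ D := by
  by_contra hc
  have hxs : x ∈ D ∩ (G.connectedComponentMk c).supp :=
    ⟨hx, SimpleGraph.ConnectedComponent.sound hxc.reachable⟩
  have hys : y ∈ D ∩ (G.connectedComponentMk c).supp :=
    ⟨hy, SimpleGraph.ConnectedComponent.sound hyc.reachable⟩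
  obtain ⟨p⟩ := (hD.2 (G.connectedComponentMk c)).preconnected ⟨x, hxs⟩ ⟨y, hys⟩
  -- A walk inside `D` avoids `c`, the only vertex at which it could leave `X`.
  have key : ∀ a b : ↥(D ∩ (G.connectedComponentMk c).supp),
      (G.induce (D ∩ (G.connectedComponentMk c).supp)).Walk a b → a.1 ∈ X → b.1 ∈ X := by
    intro a b p
    induction p with
    | nil => exact id
    | @cons u v w h _ ih =>
      intro hu
      refine ih ?_
      by_contra hv
      have : v.1 = c := hX _ _ hu hv h
      exact hc (this ▸ v.2.1)
  exact hyX (key _ _ p hxX)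

/-- Selected hypercubes stay selected under any continuation of the input. -/
theorem OnlineMCDSAlgorithm.sol_subset_append {d : ℕ} (alg : OnlineMCDSAlgorithm d)
    (σ τ : List (UnitHypercube d)) (h : (σ ++ τ).Nodup) : alg.sol σ ⊆ alg.sol (σ ++ τ) := by
  induction τ using List.reverseRecOn with
  | nil => simp
  | append_singleton τ A ih =>
    rw [← List.append_assoc] at h ⊢
    exact (ih (List.nodup_append.1 h).1).trans (alg.irrevocable _ _ h)

/-- If every object intersects the centre of its cluster, and objects of different clusters are
disjoint, then the minimum connected dominating set consists of one object for each cluster. -/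
theorem optCDS_eq_of_clusters {d k : ℕ} (σ : List (UnitHypercube d))
    (q : Fin k → UnitHypercube d) (hqσ : ∀ j, q j ∈ σ) (label : UnitHypercube d → Fin k)
    (hlabel : ∀ A ∈ σ, ∀ B ∈ σ, (A.1 ∩ B.1).Nonempty → label A = label B)
    (hlq : ∀ j, label (q j) = j)
    (hq : ∀ A ∈ σ, (A.1 ∩ (q (label A)).1).Nonempty) : optCDS σ = k := by
  classical
  have hqinj : Function.Injective q := fun i j h => by rw [← hlq i, h, hlq]
  have hlower : ∀ D : Finset (UnitHypercube d), IsCDSFor σ D → k ≤ D.card := by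
    intro D hD
    -- Each centre is dominated from within its own cluster, so every label occurs in `D`.
    have : (Finset.univ : Finset (Fin k)) ⊆ D.image label := by
      intro j _
      rw [Finset.mem_image]
      rcases hD.2.1 ⟨q j, hqσ j⟩ with h | ⟨u, hu, hadj⟩
      · exact ⟨q j, h, hlq j⟩
      · exact ⟨u.1, hu, by rw [← hlabel _ (hqσ j) _ u.2 hadj.2, hlq]⟩
    simpa using (Finset.card_le_card this).trans Finset.card_image_le
  have hupper : IsCDSFor σ (Finset.univ.image q) := by
    have hreach : ∀ u v : ↥{A | A ∈ σ}, (intersectionGraph {A | A ∈ σ}).Reachable u v →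
        label u.1 = label v.1 := by
      rintro u v ⟨p⟩
      induction p with
      | nil => rfl
      | @cons u v w h _ ih => exact (hlabel _ u.2 _ v.2 h.2).trans ih
    have hdom : ∀ v : ↥{A | A ∈ σ}, v = ⟨q (label v.1), hqσ _⟩ ∨
        (intersectionGraph {A | A ∈ σ}).Adj v ⟨q (label v.1), hqσ _⟩ := fun v =>
      or_iff_not_imp_left.2 fun h => ⟨h, hq _ v.2⟩
    refine ⟨?_, fun v => ?_, fun C => ?_⟩
    · intro A hA
      obtain ⟨j, -, rfl⟩ := Finset.mem_image.1 hA
      exact hqσ j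
    · rcases hdom v with h | h
      · exact Or.inl (by rw [h]; simp)
      · exact Or.inr ⟨_, by simp, h⟩
    · induction C using SimpleGraph.ConnectedComponent.ind with
      | h v =>
      -- Labels are constant on components, so each component contains just one centre.
      have : ({A : ↥{A | A ∈ σ} | A.1 ∈ Finset.univ.image q} ∩
          ((intersectionGraph {A | A ∈ σ}).connectedComponentMk v).supp) =
          {⟨q (label v.1), hqσ _⟩} := by
        ext u
        constructor
        · rintro ⟨hu, huv⟩
          obtain ⟨j, -, hj⟩ := Finset.mem_image.1 (Set.mem_ofPred_eq ▸ hu)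
          have := hreach _ _ (SimpleGraph.ConnectedComponent.exact huv)
          rw [← hj, hlq] at this
          rw [Set.mem_singleton_iff, Subtype.ext_iff, ← hj, this]
        · rintro rfl
          refine ⟨by simp, SimpleGraph.ConnectedComponent.sound ?_⟩
          rcases hdom v with h | h
          · rw [← h]
          · exact h.reachable.symm
      rw [this]
      exact { preconnected := fun a b => by rw [Subsingleton.elim a b]
              nonempty := inferInstance }
  refine le_antisymm (Nat.sInf_le ⟨_, hupper, ?_⟩) (le_csInf ⟨_, _, hupper, rfl⟩ ?_)
  · rw [Finset.card_image_of_injective _ hqinj, Finset.card_univ, Fintype.card_fin]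
  · rintro _ ⟨D, hD, rfl⟩
    exact hlower D hD

/-! ### Lattice cubes -/

/-- The axis-parallel unit cube centred at `51/100 • z`. -/
def latticeCube {d : ℕ} (z : Fin d → ℤ) : UnitHypercube d :=
  ⟨{x | ∀ i, |x i - 51 / 100 * z i| ≤ 1 / 2},
    IsometryEquiv.addRight (WithLp.toLp 2 fun i => (51 / 100 * z i : ℝ)), by
      ext x
      constructor
      · intro hx
        exact ⟨x - WithLp.toLp 2 fun i => (51 / 100 * z i : ℝ), by
          simpa [standardUnitCube] using hx, by simp⟩
      · rintro ⟨y, hy, rfl⟩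
        simpa [standardUnitCube] using hy⟩

theorem mem_latticeCube {d : ℕ} {z : Fin d → ℤ} {x : EuclideanSpace ℝ (Fin d)} :
    x ∈ (latticeCube z).1 ↔ ∀ i, |x i - 51 / 100 * z i| ≤ 1 / 2 := Iff.rfl

/-- The spacing is just above `1/2`: centres one step apart leave the cubes overlapping, while two
steps give `102/100 > 1`. -/
theorem latticeCube_inter_nonempty_iff {d : ℕ} (z w : Fin d → ℤ) :
    ((latticeCube z).1 ∩ (latticeCube w).1).Nonempty ↔ ∀ i, |z i - w i| ≤ 1 := by
  constructor
  · rintro ⟨x, hz, hw⟩ i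
    have h1 := abs_le.1 (mem_latticeCube.1 hz i)
    have h2 := abs_le.1 (mem_latticeCube.1 hw i)
    rw [← Int.lt_add_one_iff, abs_lt]
    constructor
    · have : (-2 : ℝ) < z i - w i := by linarith
      exact_mod_cast this
    · have : (z i - w i : ℝ) < 2 := by linarith
      exact_mod_cast this
  · intro h
    -- The midpoint of the two centres.
    refine ⟨WithLp.toLp 2 fun i => (51 / 200 * (z i + w i) : ℝ), fun i => ?_, fun i => ?_⟩
    all_goals
      have h1 : (|z i - w i| : ℝ) ≤ 1 := by exact_mod_cast h i
      rw [abs_le] at h1 ⊢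
      constructor <;> dsimp only <;> linarith

theorem latticeCube_injective {d : ℕ} :
    Function.Injective (latticeCube : (Fin d → ℤ) → UnitHypercube d) := by
  intro z w h
  have key : ∀ z w : Fin d → ℤ, latticeCube z = latticeCube w → ∀ i, z i ≤ w i := by
    intro z w h i
    have hm : (WithLp.toLp 2 fun i => (51 / 100 * z i + 1 / 2 : ℝ)) ∈ (latticeCube z).1 :=
      fun i => by rw [abs_le]; constructor <;> dsimp only <;> linarith
    rw [h] at hm
    have h1 := (abs_le.1 (mem_latticeCube.1 hm i)).2
    dsimp only at h1
    have : (z i : ℝ) ≤ w i := by linarith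
    exact_mod_cast this
  exact funext fun i => le_antisymm (key z w h i) (key w z h.symm i)

/-! ### Tilted cubes -/

/-- The isometry of `ℝ^(n+2)` that acts on the first two coordinates as a reflection followed by a
translation along the second axis. -/
noncomputable def tilt (n : ℕ) (c : ℝ) :
    EuclideanSpace ℝ (Fin (n + 2)) ≃ᵢ EuclideanSpace ℝ (Fin (n + 2)) :=
  IsometryEquiv.mk'
    (fun x => WithLp.toLp 2 (Fin.cons (4 / 5 * x 0 + 3 / 5 * x 1)
      (Fin.cons (3 / 5 * x 0 - 4 / 5 * x 1 + c) fun i => x i.succ.succ)))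
    -- The linear part is a reflection, hence its own inverse; only the translation has to be undone
    -- first.
    (fun x => WithLp.toLp 2 (Fin.cons (4 / 5 * x 0 + 3 / 5 * (x 1 - c))
      (Fin.cons (3 / 5 * x 0 - 4 / 5 * (x 1 - c)) fun i => x i.succ.succ)))
    (fun x => by
      ext i
      refine Fin.cases ?_ (fun i => Fin.cases ?_ (fun i => ?_) i) i
      · change 4 / 5 * (4 / 5 * x 0 + 3 / 5 * (x 1 - c)) +
          3 / 5 * (3 / 5 * x 0 - 4 / 5 * (x 1 - c)) = x 0
        ring
      · change 3 / 5 * (4 / 5 * x 0 + 3 / 5 * (x 1 - c)) -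
          4 / 5 * (3 / 5 * x 0 - 4 / 5 * (x 1 - c)) + c = x 1
        ring
      · rfl)
    (Isometry.of_dist_eq fun x y => by
      rw [EuclideanSpace.dist_eq, EuclideanSpace.dist_eq]
      congr 1
      simp only [Fin.sum_univ_succ, Real.dist_eq, sq_abs, Fin.cons_zero, Fin.cons_succ,
        Fin.succ_zero_eq_one]
      ring)

/-- The unit cube centred at `(0, 51/10 * j, 0, …, 0)`, tilted in its first two coordinates. -/
def tiltedCube (n : ℕ) (j : ℤ) : UnitHypercube (n + 2) :=
  ⟨{x | |4 / 5 * x 0 + 3 / 5 * (x 1 - 51 / 10 * j)| ≤ 1 / 2 ∧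
      |3 / 5 * x 0 - 4 / 5 * (x 1 - 51 / 10 * j)| ≤ 1 / 2 ∧
      ∀ i : Fin n, |x i.succ.succ| ≤ 1 / 2},
    tilt n (51 / 10 * j), by
      ext x
      rw [← IsometryEquiv.coe_toEquiv, Equiv.image_eq_preimage_symm]
      change _ ↔ ∀ i, _
      rw [Fin.forall_fin_succ, Fin.forall_fin_succ]
      rfl⟩

theorem mem_tiltedCube {n : ℕ} {j : ℤ} {x : EuclideanSpace ℝ (Fin (n + 2))} :
    x ∈ (tiltedCube n j).1 ↔ |4 / 5 * x 0 + 3 / 5 * (x 1 - 51 / 10 * j)| ≤ 1 / 2 ∧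
      |3 / 5 * x 0 - 4 / 5 * (x 1 - 51 / 10 * j)| ≤ 1 / 2 ∧
      ∀ i : Fin n, |x i.succ.succ| ≤ 1 / 2 := Iff.rfl

theorem tiltedCube_nonempty (n : ℕ) (j : ℤ) : (tiltedCube n j).1.Nonempty :=
  ⟨WithLp.toLp 2 (Fin.cons 0 (Fin.cons (51 / 10 * j) fun _ => 0)), by
    rw [mem_tiltedCube]
    simp⟩

/-- A tilted cube reaches further in the first coordinate than any axis-parallel one. -/
theorem tiltedCube_ne_latticeCube {n : ℕ} (j : ℤ) (z : Fin (n + 2) → ℤ) :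
    tiltedCube n j ≠ latticeCube z := by
  intro h
  -- Opposite corners of the tilted square, `7/5 > 1` apart in the first coordinate.
  have h1 : (WithLp.toLp 2 (Fin.cons (7 / 10) (Fin.cons (51 / 10 * j - 1 / 10) fun _ => 0)) :
      EuclideanSpace ℝ (Fin (n + 2))) ∈ (tiltedCube n j).1 := by
    rw [mem_tiltedCube]
    refine ⟨?_, ?_, fun i => ?_⟩ <;> norm_num [abs_le]
  have h2 : (WithLp.toLp 2 (Fin.cons (-7 / 10) (Fin.cons (51 / 10 * j + 1 / 10) fun _ => 0)) :
      EuclideanSpace ℝ (Fin (n + 2))) ∈ (tiltedCube n j).1 := by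
    rw [mem_tiltedCube]
    refine ⟨?_, ?_, fun i => ?_⟩ <;> norm_num [abs_le]
  rw [h] at h1 h2
  have h3 := (abs_le.1 (mem_latticeCube.1 h1 0)).2
  have h4 := (abs_le.1 (mem_latticeCube.1 h2 0)).1
  simp only [Fin.cons_zero] at h3 h4
  linarith

theorem tiltedCube_subset_strip {n : ℕ} {j : ℤ} {x : EuclideanSpace ℝ (Fin (n + 2))}
    (hx : x ∈ (tiltedCube n j).1) : |x 1 - 51 / 10 * j| ≤ 2 := by
  have h1 := abs_le.1 (mem_tiltedCube.1 hx).1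
  have h2 := abs_le.1 (mem_tiltedCube.1 hx).2.1
  rw [abs_le]
  constructor <;> linarith

theorem latticeCube_subset_strip {n : ℕ} {j : ℤ} {z : Fin (n + 2) → ℤ} (hz : |z 1 - 10 * j| ≤ 2)
    {x : EuclideanSpace ℝ (Fin (n + 2))} (hx : x ∈ (latticeCube z).1) :
    |x 1 - 51 / 10 * j| ≤ 2 := by
  have h1 := abs_le.1 (mem_latticeCube.1 hx 1)
  have h2 : (|z 1 - 10 * j| : ℝ) ≤ 2 := by exact_mod_cast hz
  rw [abs_le] at h2 ⊢
  constructor <;> linarith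

/-- Strip centres are multiples of `51/10`, which exceeds the strip width 4. -/
theorem eq_of_mem_strips {t : ℝ} {i j : ℤ} (hi : |t - 51 / 10 * i| ≤ 2)
    (hj : |t - 51 / 10 * j| ≤ 2) : i = j := by
  rw [abs_le] at hi hj
  have h1 : (i : ℝ) < j + 1 := by linarith
  have h2 : (j : ℝ) < i + 1 := by linarith
  have h3 : i < j + 1 := by exact_mod_cast h1
  have h4 : j < i + 1 := by exact_mod_cast h2
  omega

/-- The tilt is essential: the end cubes of a column leave a gap of `104/100` between them, too wide
for an axis-parallel unit cube. -/
theorem latticeCube_inter_tiltedCube {n : ℕ} {j : ℤ} {z : Fin (n + 2) → ℤ}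
    (h1 : |z 1 - 10 * j| ≤ 2) (h : ∀ i ≠ 1, |z i| ≤ 1) :
    ((latticeCube z).1 ∩ (tiltedCube n j).1).Nonempty := by
  have h0 : (|z 0| : ℝ) ≤ 1 := by exact_mod_cast h 0 (by simp)
  have h1' : (|z 1 - 10 * j| : ℝ) ≤ 2 := by exact_mod_cast h1
  have h2 : ∀ i : Fin n, (|z i.succ.succ| : ℝ) ≤ 1 := fun i => by
    exact_mod_cast h _ (by simp [Fin.ext_iff])
  rw [abs_le] at h0 h1'
  -- For extreme indices this is the point of the lattice cube nearest to the cluster centre: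
  -- offsets `51/100 - 1/2 = 1/100` and, in height, `102/100 - 1/2 = 2 * 13/50`.
  refine ⟨WithLp.toLp 2 (Fin.cons (1 / 100 * z 0)
    (Fin.cons (51 / 10 * j + 13 / 50 * (z 1 - 10 * j)) fun i => 1 / 100 * z i.succ.succ)), ?_, ?_⟩
  · rw [mem_latticeCube, Fin.forall_fin_succ, Fin.forall_fin_succ]
    change |1 / 100 * (z 0 : ℝ) - 51 / 100 * z 0| ≤ 1 / 2 ∧
      |51 / 10 * j + 13 / 50 * (z 1 - 10 * j) - 51 / 100 * (z 1 : ℝ)| ≤ 1 / 2 ∧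
      ∀ i : Fin n, |1 / 100 * (z i.succ.succ : ℝ) - 51 / 100 * z i.succ.succ| ≤ 1 / 2
    refine ⟨?_, ?_, fun i => ?_⟩
    · rw [abs_le]; constructor <;> linarith
    · rw [abs_le]; constructor <;> linarith
    · have hi := abs_le.1 (h2 i)
      rw [abs_le]
      constructor <;> linarith
  · rw [mem_tiltedCube]
    change |4 / 5 * (1 / 100 * (z 0 : ℝ)) +
        3 / 5 * (51 / 10 * j + 13 / 50 * (z 1 - 10 * j) - 51 / 10 * j)| ≤ 1 / 2 ∧
      |3 / 5 * (1 / 100 * (z 0 : ℝ)) -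
        4 / 5 * (51 / 10 * j + 13 / 50 * (z 1 - 10 * j) - 51 / 10 * j)| ≤ 1 / 2 ∧
      ∀ i : Fin n, |1 / 100 * (z i.succ.succ : ℝ)| ≤ 1 / 2
    refine ⟨?_, ?_, fun i => ?_⟩
    · rw [abs_le]; constructor <;> linarith
    · rw [abs_le]; constructor <;> linarith
    · have hi := abs_le.1 (h2 i)
      rw [abs_le]
      constructor <;> linarith

/-! ### Forced lattice cubes -/

theorem IsCDSFor.latticeCube_mem_of_isolated {d : ℕ} {σ : List (UnitHypercube d)}
    {D : Finset (UnitHypercube d)} (hD : IsCDSFor σ D) {Z : Set (Fin d → ℤ)}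
    (hσ : ∀ A, A ∈ σ ↔ A ∈ latticeCube '' Z) {z : Fin d → ℤ} (hz : z ∈ Z)
    (hiso : ∀ w ∈ Z, (∀ i, |z i - w i| ≤ 1) → z = w) : latticeCube z ∈ D := by
  refine hD.2.1.mem_of_isolated
    (v := (⟨latticeCube z, (hσ _).2 ⟨z, hz, rfl⟩⟩ : ↥{A | A ∈ σ})) ?_
  rintro ⟨A, hA⟩ ⟨hne, hint⟩
  obtain ⟨w, hw, rfl⟩ := (hσ A).1 hA
  exact hne (Subtype.ext
    (congrArg latticeCube (hiso w hw ((latticeCube_inter_nonempty_iff z w).1 hint))))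

theorem IsCDSFor.latticeCube_mem_of_separates {d : ℕ} {σ : List (UnitHypercube d)}
    {D : Finset (UnitHypercube d)} (hD : IsCDSFor σ D) {Z : Set (Fin d → ℤ)}
    (hσ : ∀ A, A ∈ σ ↔ A ∈ latticeCube '' Z) {c x y : Fin d → ℤ} (X : Set (Fin d → ℤ))
    (hc : c ∈ Z) (hx : x ∈ Z) (hy : y ∈ Z) (hxD : latticeCube x ∈ D) (hyD : latticeCube y ∈ D)
    (hxc : ∀ i, |x i - c i| ≤ 1) (hyc : ∀ i, |y i - c i| ≤ 1) (hxne : x ≠ c) (hyne : y ≠ c)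
    (hxX : x ∈ X) (hyX : y ∉ X)
    (hX : ∀ u ∈ Z, ∀ v ∈ Z, u ∈ X → v ∉ X → (∀ i, |u i - v i| ≤ 1) → v = c) :
    latticeCube c ∈ D := by
  refine hD.2.mem_of_separates
    (c := (⟨latticeCube c, (hσ _).2 ⟨c, hc, rfl⟩⟩ : ↥{A | A ∈ σ}))
    (x := ⟨latticeCube x, (hσ _).2 ⟨x, hx, rfl⟩⟩)
    (y := ⟨latticeCube y, (hσ _).2 ⟨y, hy, rfl⟩⟩) {A | A.1 ∈ latticeCube '' X}
    ⟨fun h => hxne (latticeCube_injective (congrArg Subtype.val h)),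
      (latticeCube_inter_nonempty_iff x c).2 hxc⟩
    ⟨fun h => hyne (latticeCube_injective (congrArg Subtype.val h)),
      (latticeCube_inter_nonempty_iff y c).2 hyc⟩ hxD hyD ⟨x, hxX, rfl⟩ ?_ ?_
  · rintro ⟨w, hw, h⟩
    exact hyX (latticeCube_injective h ▸ hw)
  · rintro ⟨A, hA⟩ ⟨B, hB⟩ hAX hBX hadj
    obtain ⟨u, hu, rfl⟩ := (hσ A).1 hA
    obtain ⟨v, hv, rfl⟩ := (hσ B).1 hB
    obtain ⟨u', hu', h⟩ := hAX
    obtain rfl := latticeCube_injective h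
    exact Subtype.ext (congrArg latticeCube (hX _ hu v hv hu' (fun hv' => hBX ⟨v, hv', rfl⟩)
      ((latticeCube_inter_nonempty_iff _ _).1 hadj.2)))

/-! ### The adversarial configuration -/

/-- The heights of the cubes of the columns: five consecutive ones for each of `k` clusters. -/
noncomputable def columnLevels (k : ℕ) : Finset ℤ :=
  (Finset.range k ×ˢ Finset.Icc (-2 : ℤ) 2).image fun p => 10 * p.1 + p.2

/-- Centres of the cubes of the columns: in each cluster there are `2^(n+1)` disjoint columns,
each of them an induced path of five cubes. -/
noncomputable def columns (n k : ℕ) : Finset (Fin (n + 2) → ℤ) :=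
  Fintype.piFinset (Fin.cons {-1, 1} (Fin.cons (columnLevels k) fun _ => {-1, 1}))

/-- Centres of the cubes that join pairs of columns opposite in the first coordinate. -/
noncomputable def bridges (n k : ℕ) : Finset (Fin (n + 2) → ℤ) :=
  Fintype.piFinset (Fin.cons {0} (Fin.cons ((Finset.range k).image fun j : ℕ => (10 * j : ℤ))
    fun _ => {-1, 1}))

/-- The pairwise disjoint cubes of the columns: first, middle and last cube of each column. -/
noncomputable def posts (n k : ℕ) : Finset (Fin (n + 2) → ℤ) :=
  (columns n k).filter fun z => Even (z 1)

theorem mem_columnLevels {k : ℕ} {m : ℤ} :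
    m ∈ columnLevels k ↔ ∃ j < k, -2 ≤ m - 10 * (j : ℤ) ∧ m - 10 * (j : ℤ) ≤ 2 := by
  simp only [columnLevels, Finset.mem_image, Finset.mem_product, Finset.mem_range,
    Finset.mem_Icc, Prod.exists]
  constructor
  · rintro ⟨j, b, ⟨hj, hb⟩, rfl⟩
    exact ⟨j, hj, by omega, by omega⟩
  · rintro ⟨j, hj, h⟩
    exact ⟨j, m - 10 * j, ⟨hj, h⟩, by ring⟩

theorem card_columnLevels (k : ℕ) : (columnLevels k).card = 5 * k := by
  rw [columnLevels, Finset.card_image_of_injOn]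
  · simp [mul_comm]
  · rintro ⟨i, a⟩ hi ⟨j, b⟩ hj h
    simp only [Finset.coe_product, Set.mem_prod, Finset.mem_coe, Finset.mem_range,
      Finset.mem_Icc] at hi hj h
    ext <;> dsimp only <;> omega

theorem mem_columns {n k : ℕ} {z : Fin (n + 2) → ℤ} :
    z ∈ columns n k ↔ (z 0 = -1 ∨ z 0 = 1) ∧
      (∃ j < k, -2 ≤ z 1 - 10 * (j : ℤ) ∧ z 1 - 10 * (j : ℤ) ≤ 2) ∧
      ∀ i : Fin n, z i.succ.succ = -1 ∨ z i.succ.succ = 1 := by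
  rw [columns, Fintype.mem_piFinset, Fin.forall_fin_succ, Fin.forall_fin_succ]
  simp [mem_columnLevels]

theorem mem_bridges {n k : ℕ} {z : Fin (n + 2) → ℤ} :
    z ∈ bridges n k ↔ z 0 = 0 ∧ (∃ j < k, 10 * (j : ℤ) = z 1) ∧
      ∀ i : Fin n, z i.succ.succ = -1 ∨ z i.succ.succ = 1 := by
  rw [bridges, Fintype.mem_piFinset, Fin.forall_fin_succ, Fin.forall_fin_succ]
  simp

/-- Per cluster: `5 * 2^(n+1)` column cubes and `2^n` bridges. -/
theorem card_columns_union_bridges (n k : ℕ) :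
    (columns n k ∪ bridges n k).card = 11 * 2 ^ n * k := by
  rw [Finset.card_union_of_disjoint]
  · rw [columns, bridges, Fintype.card_piFinset, Fintype.card_piFinset]
    simp only [Fin.prod_univ_succ, Fin.cons_zero, Fin.cons_succ, card_columnLevels]
    rw [Finset.card_image_of_injective _ (fun a b h => by simpa using h)]
    simp
    ring
  · rw [Finset.disjoint_left]
    intro z hc hb
    have := (mem_columns.1 hc).1
    have := (mem_bridges.1 hb).1
    omega

/-- Distinct even heights, like the values `-1` and `1`, differ by at least 2. -/
theorem eq_of_mem_posts {n k : ℕ} {z w : Fin (n + 2) → ℤ} (hz : z ∈ posts n k)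
    (hw : w ∈ posts n k) (h : ∀ i, |z i - w i| ≤ 1) : z = w := by
  obtain ⟨hz, hze⟩ := Finset.mem_filter.1 hz
  obtain ⟨hw, hwe⟩ := Finset.mem_filter.1 hw
  rw [mem_columns] at hz hw
  simp only [abs_le] at h
  refine funext fun i => Fin.cases ?_ (fun i => Fin.cases ?_ (fun i => ?_) i) i
  · have := h 0
    omega
  · have := h 1
    rw [Int.even_iff] at hze hwe
    simp only [Fin.succ_zero_eq_one]
    omega
  · have := h i.succ.succ
    have := hz.2.2 i
    have := hw.2.2 i
    omega

theorem forall_apply_update {n : ℕ} {z : Fin n → ℤ} {i : Fin n} {a : ℤ}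
    (h : |a - z i| ≤ 1) (j : Fin n) : |Function.update z i a j - z j| ≤ 1 := by
  by_cases hj : j = i
  · subst hj
    simpa using h
  · simp [hj]

theorem update_one_mem_posts {n k j : ℕ} {z : Fin (n + 2) → ℤ} {a : ℤ} (hz : z ∈ columns n k)
    (hj : j < k) (ha : a = 10 * (j : ℤ) - 2 ∨ a = 10 * (j : ℤ) ∨ a = 10 * (j : ℤ) + 2) :
    Function.update z 1 a ∈ posts n k := by
  rw [mem_columns] at hz
  have hne : ∀ i : Fin n, i.succ.succ ≠ 1 := fun i => by simp [Fin.ext_iff]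
  rw [posts, Finset.mem_filter, mem_columns]
  simp only [Function.update_self, hne, ne_eq, not_false_eq_true, Function.update_of_ne,
    zero_ne_one]
  refine ⟨⟨hz.1, ⟨j, hj, by omega, by omega⟩, hz.2.2⟩, ?_⟩
  rw [Int.even_iff]
  omega

theorem update_zero_mem_posts {n k : ℕ} {z : Fin (n + 2) → ℤ} {a : ℤ} (hz : z ∈ bridges n k)
    (ha : a = -1 ∨ a = 1) : Function.update z 0 a ∈ posts n k := by
  obtain ⟨-, ⟨j, hj, hjz⟩, hz⟩ := mem_bridges.1 hz
  rw [posts, Finset.mem_filter, mem_columns]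
  simp only [Function.update_self, ne_eq, Fin.succ_ne_zero, not_false_eq_true,
    Function.update_of_ne, one_ne_zero]
  refine ⟨⟨ha, ⟨j, hj, by omega, by omega⟩, hz⟩, ?_⟩
  rw [Int.even_iff]
  omega

/-! ### Cut vertices of the configuration -/

/-- A cube in the second or fourth place of its column is the only neighbour of an end of that
column, and so it is forced. -/
theorem IsCDSFor.latticeCube_mem_of_mem_columns {n k : ℕ} {σ : List (UnitHypercube (n + 2))}
    {D : Finset (UnitHypercube (n + 2))} (hD : IsCDSFor σ D)
    (hσ : ∀ A, A ∈ σ ↔ A ∈ latticeCube '' (↑(columns n k ∪ bridges n k) : Set _))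
    (hposts : ∀ z ∈ posts n k, latticeCube z ∈ D) {c : Fin (n + 2) → ℤ} (hc : c ∈ columns n k) :
    latticeCube c ∈ D := by
  by_cases heven : Even (c 1)
  · exact hposts c (Finset.mem_filter.2 ⟨hc, heven⟩)
  have hsub : ∀ z ∈ posts n k, z ∈ (↑(columns n k ∪ bridges n k) : Set _) := fun z hz =>
    Finset.mem_coe.2 (Finset.mem_union_left _ (Finset.mem_filter.1 hz).1)
  rw [Int.even_iff] at heven
  obtain ⟨hc0, ⟨j, hj, hcj⟩, hc2⟩ := mem_columns.1 hc
  -- `a` is the height of the column end next to `c`; that end alone is the separated set.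
  obtain ⟨a, ha, hac⟩ : ∃ a : ℤ, (a = 10 * (j : ℤ) - 2 ∨ a = 10 * (j : ℤ) + 2) ∧
      (a = c 1 - 1 ∨ a = c 1 + 1) := by
    rcases lt_or_ge (c 1) (10 * j) with h | h
    · exact ⟨10 * j - 2, by omega, by omega⟩
    · exact ⟨10 * j + 2, by omega, by omega⟩
  have hx := update_one_mem_posts hc hj (a := a) (by omega)
  have hy := update_one_mem_posts hc hj (a := 10 * j) (by omega)
  have hne : ∀ b : ℤ, b ≠ c 1 → Function.update c 1 b ≠ c := fun b hb h => hb (by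
    simpa using congrFun h 1)
  refine hD.latticeCube_mem_of_separates hσ {Function.update c 1 a}
    (Finset.mem_coe.2 (Finset.mem_union_left _ hc)) (hsub _ hx) (hsub _ hy) (hposts _ hx)
    (hposts _ hy) (forall_apply_update (by rw [abs_le]; omega))
    (forall_apply_update (by rw [abs_le]; omega)) (hne _ (by omega)) (hne _ (by omega)) rfl ?_ ?_
  · intro h
    have := congrFun (Set.mem_singleton_iff.1 h) 1
    simp only [Function.update_self] at this
    omega
  · rintro u - v hv rfl hvX h
    simp only [abs_le] at h
    have h1 := h 1
    rw [Function.update_self] at h1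
    rcases Finset.mem_union.1 (Finset.mem_coe.1 hv) with hv | hv
    · obtain ⟨hv0, ⟨i, hi, hvi⟩, hv2⟩ := mem_columns.1 hv
      have e0 : v 0 = c 0 := by
        have := h 0
        rw [Function.update_of_ne (by simp)] at this
        omega
      have e2 : ∀ l : Fin n, v l.succ.succ = c l.succ.succ := fun l => by
        have := h l.succ.succ
        rw [Function.update_of_ne (by simp [Fin.ext_iff])] at this
        have := hv2 l
        have := hc2 l
        omega
      have hva : v 1 ≠ a := fun hva => hvX (Set.mem_singleton_iff.2 (by
        rw [← hva]
        refine funext fun l => Fin.cases ?_ (fun l => Fin.cases ?_ (fun l => ?_) l) l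
        · rw [Function.update_of_ne (by simp), e0]
        · simp
        · rw [Function.update_of_ne (by simp [Fin.ext_iff]), e2]))
      refine funext fun l => Fin.cases e0 (fun l => Fin.cases ?_ e2 l) l
      simp only [Fin.succ_zero_eq_one]
      omega
    -- Bridges have heights divisible by 10, so none is within 1 of an end at height `10 * j ± 2`.
    · obtain ⟨-, ⟨i, hi, hvi⟩, -⟩ := mem_bridges.1 hv
      omega

/-- A bridge separates the two columns that it touches, and so it is forced. -/
theorem IsCDSFor.latticeCube_mem_of_mem_bridges {n k : ℕ} {σ : List (UnitHypercube (n + 2))}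
    {D : Finset (UnitHypercube (n + 2))} (hD : IsCDSFor σ D)
    (hσ : ∀ A, A ∈ σ ↔ A ∈ latticeCube '' (↑(columns n k ∪ bridges n k) : Set _))
    (hposts : ∀ z ∈ posts n k, latticeCube z ∈ D) {c : Fin (n + 2) → ℤ} (hc : c ∈ bridges n k) :
    latticeCube c ∈ D := by
  have hsub : ∀ z ∈ posts n k, z ∈ (↑(columns n k ∪ bridges n k) : Set _) := fun z hz =>
    Finset.mem_coe.2 (Finset.mem_union_left _ (Finset.mem_filter.1 hz).1)
  obtain ⟨hc0, ⟨j, hj, hcj⟩, hc2⟩ := mem_bridges.1 hc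
  have hx := update_zero_mem_posts hc (a := 1) (by omega)
  have hy := update_zero_mem_posts hc (a := -1) (by omega)
  have hne : ∀ b : ℤ, b ≠ c 0 → Function.update c 0 b ≠ c := fun b hb h => hb (by
    simpa using congrFun h 0)
  refine hD.latticeCube_mem_of_separates hσ
    -- The whole column on the positive side of the bridge; an edge can leave it only to the bridge
    -- itself.
    {w | w 0 = 1 ∧ |w 1 - c 1| ≤ 2 ∧ ∀ i : Fin n, w i.succ.succ = c i.succ.succ}
    (Finset.mem_coe.2 (Finset.mem_union_right _ hc)) (hsub _ hx) (hsub _ hy) (hposts _ hx)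
    (hposts _ hy) (forall_apply_update (by rw [hc0]; simp))
    (forall_apply_update (by rw [hc0]; simp)) (hne _ (by omega)) (hne _ (by omega)) ?_ ?_ ?_
  · simp
  · simp
  · rintro u - v hv ⟨hu0, hu1, hu2⟩ hvX h
    simp only [abs_le] at h hu1
    have h1 := h 1
    have h0 := h 0
    have e2 : ∀ l : Fin n, v l.succ.succ = c l.succ.succ := fun l => by
      have hl := h l.succ.succ
      rw [hu2] at hl
      have := hc2 l
      rcases Finset.mem_union.1 (Finset.mem_coe.1 hv) with hv | hv
      · have := (mem_columns.1 hv).2.2 l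
        omega
      · have := (mem_bridges.1 hv).2.2 l
        omega
    rcases Finset.mem_union.1 (Finset.mem_coe.1 hv) with hv | hv
    · obtain ⟨hv0, ⟨i, hi, hvi⟩, -⟩ := mem_columns.1 hv
      refine absurd ⟨?_, ?_, e2⟩ hvX
      · omega
      · rw [abs_le]
        omega
    · obtain ⟨hv0, ⟨i, hi, hvi⟩, -⟩ := mem_bridges.1 hv
      refine funext fun l => Fin.cases (hv0.trans hc0.symm) (fun l => Fin.cases ?_ e2 l) l
      simp only [Fin.succ_zero_eq_one]
      omega

/-! ### The adversarial input and the lower bound -/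

/-- There is an input on which the optimum is `k`, while any online algorithm selects all of the
`11 * 2 ^ n * k` lattice cubes. -/
theorem OnlineMCDSAlgorithm.exists_input (n k : ℕ) (hk : k ≠ 0)
    (alg : OnlineMCDSAlgorithm (n + 2)) :
    ∃ σ : List (UnitHypercube (n + 2)), σ.Nodup ∧ optCDS σ = k ∧
      11 * 2 ^ n * k ≤ (alg.sol σ).card := by
  classical
  set Z := columns n k ∪ bridges n k with hZ
  have hsub : posts n k ⊆ Z :=
    (Finset.filter_subset _ _).trans Finset.subset_union_left
  -- Only feasibility after `σ₁` and after `σ₂` is used, so the order within each phase is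
  -- arbitrary.
  set σ₁ := (posts n k).toList.map latticeCube with hσ₁
  set σ₂ := σ₁ ++ (Z \ posts n k).toList.map latticeCube with hσ₂
  set τ := List.ofFn fun j : Fin k => tiltedCube n j with hτ
  have mem₁ : ∀ A, A ∈ σ₁ ↔ A ∈ latticeCube '' (↑(posts n k) : Set _) := fun A => by
    simp [hσ₁]
  have mem₂ : ∀ A, A ∈ σ₂ ↔ A ∈ latticeCube '' (↑Z : Set _) := fun A => by
    rw [hσ₂, ← List.map_append, List.mem_map]
    simp only [List.mem_append, Finset.mem_toList, Finset.mem_sdiff, Set.mem_image,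
      Finset.mem_coe]
    refine exists_congr fun z => and_congr_left fun _ => ?_
    by_cases hz : z ∈ posts n k
    · simp [hz, hsub hz]
    · simp [hz]
  have memτ : ∀ A, A ∈ τ ↔ ∃ j : Fin k, tiltedCube n j = A := fun A => by
    rw [hτ, List.mem_ofFn']
    rfl
  have nodup₂ : σ₂.Nodup := by
    rw [hσ₂, ← List.map_append]
    refine List.Nodup.map latticeCube_injective (List.nodup_append.2
      ⟨Finset.nodup_toList _, Finset.nodup_toList _, ?_⟩)
    rintro a ha b hb rfl
    exact (Finset.mem_sdiff.1 (Finset.mem_toList.1 hb)).2 (Finset.mem_toList.1 ha)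
  have nodup : (σ₂ ++ τ).Nodup := by
    refine List.nodup_append.2 ⟨nodup₂, List.nodup_ofFn.2 fun i j h => ?_, ?_⟩
    · obtain ⟨x, hx⟩ := tiltedCube_nonempty n i
      have h' : x ∈ (tiltedCube n j).1 := h ▸ hx
      have := eq_of_mem_strips (tiltedCube_subset_strip hx) (tiltedCube_subset_strip h')
      exact Fin.ext (by exact_mod_cast this)
    · rintro A hA B hB rfl
      obtain ⟨z, -, rfl⟩ := (mem₂ A).1 hA
      obtain ⟨j, hj⟩ := (memτ _).1 hB
      exact tiltedCube_ne_latticeCube _ _ hj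
  refine ⟨σ₂ ++ τ, nodup, ?_, ?_⟩
  -- Supplies a default label in `Fin k`, needed by `choose!` for cubes outside the input.
  · have : NeZero k := ⟨hk⟩
    have hex : ∀ A ∈ σ₂ ++ τ, ∃ j : Fin k, (∀ x ∈ A.1, |x 1 - 51 / 10 * ((j : ℕ) : ℤ)| ≤ 2) ∧
        (A.1 ∩ (tiltedCube n j).1).Nonempty := by
      intro A hA
      rcases List.mem_append.1 hA with hA | hA
      · obtain ⟨z, hz, rfl⟩ := (mem₂ A).1 hA
        have hz' : ∃ j < k, |z 1 - 10 * (j : ℤ)| ≤ 2 ∧ ∀ i ≠ 1, |z i| ≤ 1 := by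
          rcases Finset.mem_union.1 (Finset.mem_coe.1 hz) with hz | hz
          · obtain ⟨h0, ⟨j, hj, h1⟩, h2⟩ := mem_columns.1 hz
            refine ⟨j, hj, abs_le.2 (by omega), fun i => Fin.cases (fun _ => ?_)
              (fun i => Fin.cases (fun h => absurd rfl h) (fun i _ => ?_) i) i⟩
            · rw [abs_le]; omega
            · have := h2 i
              rw [abs_le]; omega
          · obtain ⟨h0, ⟨j, hj, h1⟩, h2⟩ := mem_bridges.1 hz
            refine ⟨j, hj, abs_le.2 (by omega), fun i => Fin.cases (fun _ => ?_)
              (fun i => Fin.cases (fun h => absurd rfl h) (fun i _ => ?_) i) i⟩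
            · rw [abs_le]; omega
            · have := h2 i
              rw [abs_le]; omega
        obtain ⟨j, hj, h1, h2⟩ := hz'
        exact ⟨⟨j, hj⟩, fun x hx => latticeCube_subset_strip h1 hx,
          latticeCube_inter_tiltedCube h1 h2⟩
      · obtain ⟨j, rfl⟩ := (memτ A).1 hA
        exact ⟨j, fun x hx => tiltedCube_subset_strip hx, by
          simpa using tiltedCube_nonempty n j⟩
    choose! label hstrip hmeet using hex
    have hq : ∀ j : Fin k, tiltedCube n j ∈ σ₂ ++ τ := fun j =>
      List.mem_append_right _ ((memτ _).2 ⟨j, rfl⟩)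
    refine optCDS_eq_of_clusters _ (fun j : Fin k => tiltedCube n j) hq label ?_ ?_ hmeet
    · rintro A hA B hB ⟨x, hxA, hxB⟩
      have := eq_of_mem_strips (hstrip A hA x hxA) (hstrip B hB x hxB)
      exact Fin.ext (by exact_mod_cast this)
    · intro j
      obtain ⟨x, hx⟩ := tiltedCube_nonempty n j
      have := eq_of_mem_strips (hstrip _ (hq j) x hx) (tiltedCube_subset_strip hx)
      exact Fin.ext (by exact_mod_cast this)
  · have hposts : ∀ z ∈ posts n k, latticeCube z ∈ alg.sol σ₂ := fun z hz =>
      alg.sol_subset_append _ _ nodup₂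
        ((alg.feasible σ₁ (List.nodup_append.1 nodup₂).1).latticeCube_mem_of_isolated mem₁ hz
          fun w hw h => eq_of_mem_posts hz hw h)
    have hall : Z.image latticeCube ⊆ alg.sol (σ₂ ++ τ) := by
      intro A hA
      obtain ⟨z, hz, rfl⟩ := Finset.mem_image.1 hA
      refine alg.sol_subset_append _ _ nodup ?_
      rcases Finset.mem_union.1 hz with hz | hz
      · exact (alg.feasible σ₂ nodup₂).latticeCube_mem_of_mem_columns mem₂ hposts hz
      · exact (alg.feasible σ₂ nodup₂).latticeCube_mem_of_mem_bridges mem₂ hposts hz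
    rw [← card_columns_union_bridges, ← Finset.card_image_of_injective _ latticeCube_injective]
    exact Finset.card_le_card hall

/-- The forced cost and the optimum both scale with the number of clusters, so the bound is uniform
in `k` and implies both claims of the main theorem. -/
theorem OnlineMCDSAlgorithm.le_competitiveRatio (n k : ℕ) (hk : k ≠ 0)
    (alg : OnlineMCDSAlgorithm (n + 2)) :
    (11 * 2 ^ n : ℝ≥0∞) ≤ alg.competitiveRatio k := by
  refine le_sInf fun α hα => ?_
  obtain ⟨σ, hσ, hopt, hcard⟩ := alg.exists_input n k hk
  have h := hα σ hσ hopt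
  rw [hopt] at h
  have h' : (11 * 2 ^ n * k : ℝ≥0∞) ≤ α * k := le_trans (by exact_mod_cast hcard) h
  exact (ENNReal.mul_le_mul_iff_left (by exact_mod_cast hk) (ENNReal.natCast_ne_top k)).1 h'

theorem mainTheorem8 (d : ℕ) (hd : 2 ≤ d) (alg : OnlineMCDSAlgorithm d) :
    (11 * 2 ^ (d - 2) - 1 : ℝ≥0∞) ≤ alg.competitiveRatio 1 ∧
      ∀ k : ℕ, 2 ≤ k → (11 * 2 ^ (d - 2) / 3 : ℝ≥0∞) ≤ alg.competitiveRatio k := by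
  obtain ⟨n, rfl⟩ : ∃ n, d = n + 2 := ⟨d - 2, by omega⟩
  rw [Nat.add_sub_cancel]
  refine ⟨tsub_le_self.trans (alg.le_competitiveRatio n 1 one_ne_zero), fun k hk => ?_⟩
  refine le_trans (ENNReal.div_le_of_le_mul ?_) (alg.le_competitiveRatio n k (by omega))
  exact le_mul_of_one_le_right' (by norm_num)
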